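/- Let $n\ge 2$, and write $\mathbb{D}$ for the open unit disc in $\mathbb{C}$ and $A=[a_{j,k}]$ for a matrix $A\in\mathbb{C}^{n\times n}$. Let $$E:=\{[w]\oplus (z\,\mathbb{I}_{n-1}) : z,w\in\mathbb{C}\}\subset\mathbb{C}^{n\times n},\qquad \mu_E(A):=\big(\inf\{\|X\| : X\in E,\ \mathbb{I}-AX \text{ is singular}\}\big)^{-1},$$ where $\|\cdot\|$ is the operator norm relative to the Euclidean norm on $\mathbb{C}^n$ (with $\inf\varnothing=\infty$ and $\infty^{-1}=0$), and let $\Omega_{1,n}:=\{A\in\mathbb{C}^{n\times n} : \mu_E(A)<1\}$. Let $\mathbb{G}_{1,n}$ be the set of all $(x,y)\in\mathbb{C}^n\times\mathbb{C}^{n-1}$ such that the polynomial $$1+\sum_{j=1}^{n-1}(-1)^jy_jz^j-w\sum_{j=0}^{n-1}(-1)^jx_{j+1}z^j$$ has no zero $(z,w)$ in $\overline{\mathbb{D}}^2$. For $A\in\mathbb{C}^{n\times n}$ let $A^{\bullet}$ be the $(n-1)\times(n-1)$ matrix obtained by deleting the first row and the first column of $A$. A square matrix is called non-derogatory if it admits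 a cyclic vector. Let $\widetilde{\Omega}_{1,n}$ be the set of all $A\in\Omega_{1,n}$ such that $A^{\bullet}$ is non-derogatory and $(a_{2,1},\dots,a_{n,1})$ is a cyclic vector of $A^{\bullet}$. For $I\subseteq\{1,\dots,n\}$ let $A_I$ be the submatrix of $A$ with rows and columns indexed by $I$, and define $\pi_n:\mathbb{C}^{n\times n}\to\mathbb{C}^n\times\mathbb{C}^{n-1}$ by $\pi_n(A):=(x_1,\dots,x_n;\,y_1,\dots,y_{n-1})$, where $$x_j:=\sum_{|I|=j,\ 1\in I}\det(A_I)\quad(1\le j\le n),\qquad y_j:=\sum_{|I|=j,\ 1\notin I}\det(A_I)\quad(1\le j\le n-1);$$ in particular $x_1=a_{1,1}$. Then: 1. The set $\Omega_{1,n}\setminus\widetilde{\Omega}_{1,n}$ has Lebesgue measure zero in $\mathbb{C}^{n\times n}$. 2. The map $\pi_n$ is holomorphic and maps $\Omega_{1,n}$ onto $\mathbb{G}_{1,n}$, that is, $\pi_n(\Omega_{1,n})=\mathbb{G}_{1,n}$. 3. Let $\zeta_1,\dots,\zeta_M$ be distinct points in $\mathbb{D}$ and let $W_1,\dots,W_M\in\widetilde{\Omega}_{1,n}$.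 There exists a holomorphic map $F:\mathbb{D}\to\Omega_{1,n}$ satisfying $F(\zeta_j)=W_j$ for every $j\le M$ if and only if there exists a holomorphic map $f:\mathbb{D}\to\mathbb{G}_{1,n}$ satisfying $f(\zeta_j)=\pi_n(W_j)$ for every $j\le M$. -/

import Mathlib

open scoped ENNReal

/-- The structured singular value
`μ_E(A) = (inf {‖X‖ : X ∈ E, I - A X singular})⁻¹` of a complex `ι × ι` matrix `A`, where `‖·‖` is
the operator norm relative to the Euclidean norm. It takes values in `[0, ∞]`, with
`inf ∅ = ∞` and `∞⁻¹ = 0`. -/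
noncomputable def structuredSingularValue {ι : Type*} [Fintype ι] [DecidableEq ι]
    (E : Submodule ℂ (Matrix ι ι ℂ)) (A : Matrix ι ι ℂ) : ℝ≥0∞ :=
  (⨅ X ∈ {X : Matrix ι ι ℂ | X ∈ E ∧ (1 - A * X).det = 0},
    ‖Matrix.toEuclideanCLM (n := ι) (𝕜 := ℂ) X‖ₑ)⁻¹

/-- The unit `μ_E`-ball `Ω_E = {W : μ_E(W) < 1}`. -/
def muBall {ι : Type*} [Fintype ι] [DecidableEq ι] (E : Submodule ℂ (Matrix ι ι ℂ)) :
    Set (Matrix ι ι ℂ) :=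
  {W | structuredSingularValue E W < 1}

/-- For `n = m + 1`, the space `E^{1,n} = {[w] ⊕ (z I_{n-1}) : z, w ∈ ℂ}` of complex
`n × n` matrices; the index `0 : Fin (m + 1)` is the first row or column. -/
def structureSpace (m : ℕ) : Submodule ℂ (Matrix (Fin (m + 1)) (Fin (m + 1)) ℂ) where
  carrier := {X | ∃ w z : ℂ, X = Matrix.diagonal (Fin.cons w fun _ : Fin m => z)}
  zero_mem' := by
    refine ⟨0, 0, ?_⟩
    rw [eq_comm, Matrix.diagonal_eq_zero]
    funext i
    cases i using Fin.cases <;> simp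
  add_mem' := by
    rintro _ _ ⟨w, z, rfl⟩ ⟨w', z', rfl⟩
    refine ⟨w + w', z + z', ?_⟩
    rw [Matrix.diagonal_add]
    congr 1
    funext i
    cases i using Fin.cases <;> simp
  smul_mem' := by
    rintro c _ ⟨w, z, rfl⟩
    refine ⟨c * w, c * z, ?_⟩
    rw [← Matrix.diagonal_smul]
    congr 1
    funext i
    cases i using Fin.cases <;> simp

/-- `Ω_{1,n}` for `n = m + 1`. -/
def Omega (m : ℕ) : Set (Matrix (Fin (m + 1)) (Fin (m + 1)) ℂ) :=
  muBall (structureSpace m)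

/-- `v` is a cyclic vector of `X`: the vectors `v, X v, X² v, …` span the whole space. -/
def IsCyclicVector {ι : Type*} [Fintype ι] [DecidableEq ι] (X : Matrix ι ι ℂ) (v : ι → ℂ) : Prop :=
  Submodule.span ℂ (Set.range fun k : ℕ => (X ^ k).mulVec v) = ⊤

/-- A square matrix is non-derogatory if it admits a cyclic vector. -/
def NonDerogatory {ι : Type*} [Fintype ι] [DecidableEq ι] (X : Matrix ι ι ℂ) : Prop :=
  ∃ v : ι → ℂ, IsCyclicVector X v

/-- The matrix obtained from `A` by deleting the first row and the first column. -/
def deleteFirst {m : ℕ} (A : Matrix (Fin (m + 1)) (Fin (m + 1)) ℂ) : Matrix (Fin m) (Fin m) ℂ :=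
  A.submatrix Fin.succ Fin.succ

/-- The set of those `A ∈ Ω_{1,n}` whose lower-right block is non-derogatory, with the rest
`(a_{2,1}, …, a_{n,1})` of the first column as a cyclic vector. -/
def OmegaTilde (m : ℕ) : Set (Matrix (Fin (m + 1)) (Fin (m + 1)) ℂ) :=
  {A | A ∈ Omega m ∧ NonDerogatory (deleteFirst A) ∧
    IsCyclicVector (deleteFirst A) fun i : Fin m => A i.succ 0}

/-- The principal minor `det (A_I)`, with rows and columns indexed by `I`. -/
def principalMinor {ι : Type*} [DecidableEq ι] (A : Matrix ι ι ℂ) (I : Finset ι) : ℂ :=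
  (A.submatrix (Subtype.val : I → ι) (Subtype.val : I → ι)).det

/-- The map `π_n = (X, Y) : ℂ^{n×n} → ℂⁿ × ℂ^{n-1}` for `n = m + 1`. Increasing `j`-tuples are
`j`-element subsets `I`, and `i₁ = 1` means that `I` contains the first index.
`X_j` (for `1 ≤ j ≤ n`) is the sum of the `j × j` principal minors that contain the first index (so
`X_1 = a_{1,1}`), and `Y_j` (for `1 ≤ j ≤ n - 1`) the sum of those that do not; both are
stored at position `j - 1`. -/
def piMap (m : ℕ) (A : Matrix (Fin (m + 1)) (Fin (m + 1)) ℂ) :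
    (Fin (m + 1) → ℂ) × (Fin m → ℂ) :=
  (fun j => ∑ I : Finset (Fin (m + 1)) with I.card = (j : ℕ) + 1 ∧ 0 ∈ I, principalMinor A I,
   fun j => ∑ I : Finset (Fin (m + 1)) with I.card = (j : ℕ) + 1 ∧ 0 ∉ I, principalMinor A I)

/-- The `μ_{1,n}`-quotient `𝔾_{1,n}` for `n = m + 1`: all `(x, y) ∈ ℂⁿ × ℂ^{n-1}` for which
`1 + ∑_{j=1}^{n-1} (-1)^j y_j z^j - w ∑_{j=0}^{n-1} (-1)^j x_{j+1} z^j` has no zero `(z, w)` in the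
closed bidisc. Here `p.1 j` is `x_{j+1}` and `p.2 j` is `y_{j+1}`. -/
def muQuotient (m : ℕ) : Set ((Fin (m + 1) → ℂ) × (Fin m → ℂ)) :=
  {p | ∀ z w : ℂ, ‖z‖ ≤ 1 → ‖w‖ ≤ 1 →
    (1 + ∑ j : Fin m, (-1) ^ ((j : ℕ) + 1) * p.2 j * z ^ ((j : ℕ) + 1)) -
      w * ∑ j : Fin (m + 1), (-1) ^ (j : ℕ) * p.1 j * z ^ (j : ℕ) ≠ 0}

/-! For X = [w] ⊕ z·1, `det (1 - A * X)` equals p(z) - w q(z), where the coefficients of p and q are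
the coordinates of `piMap m A` up to sign. Since ‖X‖ = max(|w|, |z|), μ_E(A) < 1 says that p - wq
has no zero in the closed bidisc, compactness of the bidisc supplying the strict inequality. So
`Omega m` is the preimage of `muQuotient m` under `piMap` (`mem_Omega_iff`). With a section of
`piMap` this gives surjectivity, and composition with `piMap` gives one direction of the
interpolation equivalence.

The section is `canonicalMatrix`, a companion block bordered by the column e_1. For the other
direction, a given f is lifted to `canonicalMatrix (f z)`, whose values at the nodes need
correcting. Conjugation by [1] ⊕ T commutes with X and so preserves `piMap` (`piMap_conj`).
Cyclicity of the first column makes each W_j such a conjugate, by some T_j, of the canonical matrix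
with the same coordinates (`exists_eq_conj_canonicalMatrix`). An entire family T(z) of invertible
matrices with T(ζ_j) = T_j (`exists_entire_invertible_interpolation`) then corrects all nodes at
once.

The exceptional set is null because a vanishing Krylov determinant is necessary for membership, and
on every complex line in one fixed direction this determinant has finitely many zeros. -/

/-! ### The two polynomials encoding a point (x, y) -/

open Polynomial in
/-- The polynomial `1 + ∑ (-1)^j y_j z^j`. -/
noncomputable def denomPoly {m : ℕ} (y : Fin m → ℂ) : ℂ[X] :=
  1 + ∑ j : Fin m, C ((-1) ^ ((j : ℕ) + 1) * y j) * X ^ ((j : ℕ) + 1)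

open Polynomial in
/-- The polynomial `∑ (-1)^j x_{j+1} z^j`. -/
noncomputable def numPoly {m : ℕ} (x : Fin m → ℂ) : ℂ[X] :=
  ∑ j : Fin m, C ((-1) ^ (j : ℕ) * x j) * X ^ (j : ℕ)

lemma eval_denomPoly {m : ℕ} (y : Fin m → ℂ) (z : ℂ) :
    (denomPoly y).eval z = 1 + ∑ j : Fin m, (-1) ^ ((j : ℕ) + 1) * y j * z ^ ((j : ℕ) + 1) := by
  simp [denomPoly, Polynomial.eval_finsetSum]

lemma eval_numPoly {m : ℕ} (x : Fin m → ℂ) (z : ℂ) :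
    (numPoly x).eval z = ∑ j : Fin m, (-1) ^ (j : ℕ) * x j * z ^ (j : ℕ) := by
  simp [numPoly, Polynomial.eval_finsetSum]

lemma coeff_numPoly {m : ℕ} (x : Fin m → ℂ) (k : Fin m) :
    (numPoly x).coeff k = (-1) ^ (k : ℕ) * x k := by
  simp only [numPoly, Polynomial.finsetSum_coeff, Polynomial.coeff_C_mul, Polynomial.coeff_X_pow,
    Fin.val_inj]
  simp

lemma coeff_denomPoly_succ {m : ℕ} (y : Fin m → ℂ) (k : Fin m) :
    (denomPoly y).coeff (k + 1) = (-1) ^ ((k : ℕ) + 1) * y k := by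
  simp only [denomPoly, Polynomial.coeff_add, Polynomial.finsetSum_coeff, Polynomial.coeff_C_mul,
    Polynomial.coeff_X_pow, add_left_inj, Fin.val_inj, Polynomial.coeff_one]
  simp

lemma coeff_denomPoly_zero {m : ℕ} (y : Fin m → ℂ) : (denomPoly y).coeff 0 = 1 := by
  simp [denomPoly, Polynomial.finsetSum_coeff, Polynomial.coeff_X_pow]

lemma denomPoly_ne_zero {m : ℕ} (y : Fin m → ℂ) : denomPoly y ≠ 0 := by
  intro h
  simpa [h] using coeff_denomPoly_zero y

lemma numPoly_injective {m : ℕ} : Function.Injective (numPoly (m := m)) := by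
  intro x x' h
  ext k
  have := congrArg (fun p => p.coeff (k : ℕ)) h
  simpa [coeff_numPoly] using this

lemma denomPoly_injective {m : ℕ} : Function.Injective (denomPoly (m := m)) := by
  intro x x' h
  ext k
  have := congrArg (fun p => p.coeff ((k : ℕ) + 1)) h
  simpa [coeff_denomPoly_succ] using this

lemma mem_muQuotient_iff {m : ℕ} (p : (Fin (m + 1) → ℂ) × (Fin m → ℂ)) :
    p ∈ muQuotient m ↔ ∀ z w : ℂ, ‖z‖ ≤ 1 → ‖w‖ ≤ 1 →
      (denomPoly p.2).eval z - w * (numPoly p.1).eval z ≠ 0 := by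
  simp only [muQuotient, eval_denomPoly, eval_numPoly, Set.mem_ofPred_eq]

/-! ### The determinant of the structured pencil -/

/-- Expansion of `det (1 - A diag(d))` in principal minors. -/
lemma det_one_sub_mul_diagonal {ι : Type*} [Fintype ι] [DecidableEq ι] (A : Matrix ι ι ℂ)
    (d : ι → ℂ) :
    (1 - A * Matrix.diagonal d).det = ∑ I : Finset ι, (∏ i ∈ I, -d i) * principalMinor A I := by
  -- Column i of the matrix is -d_i times column i of A plus a basis vector. Transposing turns
  -- columns into rows, so that multilinearity in the rows expands the determinant over subsets.
  have h : (1 - A * Matrix.diagonal d).transpose =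
      Matrix.of ((fun i => (-d i) • A.transpose.row i) + (1 : Matrix ι ι ℂ).row) := by
    ext i j
    change (1 - A * Matrix.diagonal d) j i = -d i * A j i + (1 : Matrix ι ι ℂ) i j
    simp only [Matrix.sub_apply, Matrix.one_apply, Matrix.mul_diagonal, eq_comm (a := j)]
    ring
  rw [← Matrix.det_transpose, h]
  refine ((Matrix.detRowAlternating (R := ℂ) (n := ι)).toMultilinearMap.map_add_univ _ _).trans
    (Finset.sum_congr rfl fun s _ => ?_)
  have h2 : s.piecewise (fun i => (-d i) • A.transpose.row i) (1 : Matrix ι ι ℂ).row =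
      s.piecewise (fun i => (-d i) • s.piecewise A.transpose.row (1 : Matrix ι ι ℂ).row i)
        (s.piecewise A.transpose.row (1 : Matrix ι ι ℂ).row) := by
    ext i j
    by_cases hi : i ∈ s <;> simp [Finset.piecewise, hi]
  rw [h2, MultilinearMap.map_piecewise_smul, principalMinor, ← Matrix.det_transpose,
    Matrix.transpose_submatrix, ← Matrix.det_piecewise_one_eq_submatrix_det]
  rfl

lemma prod_neg_cons {m : ℕ} (w z : ℂ) (I : Finset (Fin (m + 1))) :
    ∏ i ∈ I, -(Fin.cons w (fun _ => z) : Fin (m + 1) → ℂ) i =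
      if 0 ∈ I then -w * (-z) ^ (I.card - 1) else (-z) ^ I.card := by
  have key : ∀ J : Finset (Fin (m + 1)), 0 ∉ J →
      ∏ i ∈ J, -(Fin.cons w (fun _ => z) : Fin (m + 1) → ℂ) i = (-z) ^ J.card := by
    intro J hJ
    refine Finset.prod_eq_pow_card fun i hi => ?_
    cases i using Fin.cases with
    | zero => exact absurd hi hJ
    | succ i => simp
  split_ifs with h
  · rw [← Finset.mul_prod_erase I _ h, key _ (Finset.notMem_erase 0 I), Finset.card_erase_of_mem h]
    simp
  · exact key I h

/-- `det (1 - A ([w] ⊕ z 1))` in terms of the coordinates of `piMap`. -/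
lemma det_one_sub_mul_structure {m : ℕ} (A : Matrix (Fin (m + 1)) (Fin (m + 1)) ℂ) (w z : ℂ) :
    (1 - A * Matrix.diagonal (Fin.cons w fun _ => z)).det =
      (denomPoly (piMap m A).2).eval z - w * (numPoly (piMap m A).1).eval z := by
  rw [det_one_sub_mul_diagonal, eval_denomPoly, eval_numPoly]
  simp only [piMap, prod_neg_cons, Finset.mul_sum, Finset.sum_mul, Finset.sum_filter]
  rw [Finset.sum_comm, Finset.sum_comm (s := (Finset.univ : Finset (Fin (m + 1))))]
  -- The constant term 1 is the contribution of the empty minor; written this way, both sides are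
  -- compared subset by subset.
  have h1 : (1 : ℂ) = ∑ I : Finset (Fin (m + 1)), if I = ∅ then 1 else 0 := by simp
  nth_rw 1 [h1]
  rw [← Finset.sum_add_distrib, ← Finset.sum_sub_distrib]
  refine Finset.sum_congr rfl fun I _ => ?_
  have hcard : I.card ≤ m + 1 := by simpa using Finset.card_le_univ I
  by_cases hI : 0 ∈ I
  · have hpos : 0 < I.card := Finset.card_pos.2 ⟨0, hI⟩
    have hne : I ≠ ∅ := Finset.ne_empty_of_mem hI
    rw [Finset.sum_eq_zero, Finset.sum_eq_single (⟨I.card - 1, by omega⟩ : Fin (m + 1))]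
    · have : I.card = I.card - 1 + 1 := by omega
      simp only [hI, hne, ← this, if_true, if_false, and_true]
      rw [neg_pow z]
      ring
    · intro j _ hj
      rw [if_neg]
      · simp
      · rintro ⟨h, -⟩
        exact hj (Fin.ext (by simp [h]))
    · simp
    · simp [hI]
  · rw [Finset.sum_eq_zero (f := fun j : Fin (m + 1) => _)]
    · rcases Finset.eq_empty_or_nonempty I with rfl | hne
      · simp [principalMinor]
      · have hpos : 0 < I.card := Finset.card_pos.2 hne
        have hlt : I.card < m + 1 := by
          refine lt_of_le_of_ne hcard fun h => hI ?_
          have : I = Finset.univ := (Finset.card_eq_iff_eq_univ I).1 (by simpa using h)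
          simp [this]
        rw [Finset.sum_eq_single (⟨I.card - 1, by omega⟩ : Fin m)]
        · have : I.card = I.card - 1 + 1 := by omega
          simp only [hI, hne.ne_empty, ← this, if_true, if_false, not_false_eq_true, and_true]
          rw [neg_pow z]
          ring
        · intro j _ hj
          rw [if_neg]
          · simp
          · rintro ⟨h, -⟩
            exact hj (Fin.ext (by simp [h]))
        · simp
    · simp [hI]

lemma eq_of_forall_eval_pencil_eq {p p' q q' : Polynomial ℂ}
    (h : ∀ w z : ℂ, p.eval z - w * q.eval z = p'.eval z - w * q'.eval z) : p = p' ∧ q = q' := by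
  have hp : p = p' := Polynomial.funext fun z => by simpa using h 0 z
  refine ⟨hp, Polynomial.funext fun z => ?_⟩
  have := h 1 z
  rw [hp] at this
  simpa using this

/-- The pencil determines all coordinates, so `piMap` can be computed without handling individual
minors. -/
lemma piMap_eq_of_forall_pencil {m : ℕ} {A : Matrix (Fin (m + 1)) (Fin (m + 1)) ℂ}
    {p : (Fin (m + 1) → ℂ) × (Fin m → ℂ)}
    (h : ∀ w z : ℂ, (1 - A * Matrix.diagonal (Fin.cons w fun _ => z)).det =
      (denomPoly p.2).eval z - w * (numPoly p.1).eval z) : piMap m A = p := by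
  simp only [det_one_sub_mul_structure] at h
  obtain ⟨h1, h2⟩ := eq_of_forall_eval_pencil_eq h
  exact Prod.ext (numPoly_injective h2) (denomPoly_injective h1)

/-! ### Cramer's rule and bordered matrices -/

/-- Cramer's rule for the first coordinate. -/
lemma det_mul_eq_of_mulVec_eq_single {n : ℕ} (N : Matrix (Fin (n + 1)) (Fin (n + 1)) ℂ)
    (u : Fin (n + 1) → ℂ) (d : ℂ) (h : N.mulVec u = Pi.single 0 d) :
    N.det * u 0 = d * (N.submatrix Fin.succ Fin.succ).det := by
  have h1 : N.cramer (N.mulVec u) 0 = N.det * u 0 := by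
    rw [Matrix.cramer_eq_adjugate_mulVec, Matrix.mulVec_mulVec, Matrix.adjugate_mul,
      Matrix.smul_mulVec, Matrix.one_mulVec]
    simp
  rw [← h1, h, Matrix.cramer_apply, Matrix.det_succ_column_zero, Fin.sum_univ_succ]
  have : ∀ i : Fin n, (N.updateCol 0 (Pi.single 0 d)) i.succ 0 = 0 := by simp
  simp only [this]
  simp only [mul_zero, zero_mul, Finset.sum_const_zero, add_zero, Fin.val_zero, pow_zero, one_mul,
    Matrix.updateCol_self, Pi.single_eq_same, Fin.succAbove_zero]
  congr 2

/-- The matrix `[[a, r], [c, B]]`. -/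
def bordered {m : ℕ} (a : ℂ) (r c : Fin m → ℂ) (B : Matrix (Fin m) (Fin m) ℂ) :
    Matrix (Fin (m + 1)) (Fin (m + 1)) ℂ :=
  Matrix.of (Fin.cons (Fin.cons a r) fun i => Fin.cons (c i) (B i))

section bordered
variable {m : ℕ} (a : ℂ) (r c : Fin m → ℂ) (B : Matrix (Fin m) (Fin m) ℂ)

@[simp] lemma bordered_zero_zero : bordered a r c B 0 0 = a := rfl
@[simp] lemma bordered_zero_succ (j : Fin m) : bordered a r c B 0 j.succ = r j := rfl
@[simp] lemma bordered_succ_zero (i : Fin m) : bordered a r c B i.succ 0 = c i := rfl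
@[simp] lemma bordered_succ_succ (i j : Fin m) : bordered a r c B i.succ j.succ = B i j := rfl

lemma deleteFirst_bordered : deleteFirst (bordered a r c B) = B := rfl

lemma bordered_mul (T : Matrix (Fin m) (Fin m) ℂ) :
    bordered a r c B * bordered 1 0 0 T = bordered a (Matrix.vecMul r T) c (B * T) := by
  ext i j
  cases i using Fin.cases <;> cases j using Fin.cases <;>
    simp [Matrix.mul_apply, Fin.sum_univ_succ, Matrix.vecMul, dotProduct]

lemma mul_bordered (T : Matrix (Fin m) (Fin m) ℂ) :
    bordered 1 0 0 T * bordered a r c B = bordered a r (T.mulVec c) (T * B) := by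
  ext i j
  cases i using Fin.cases <;> cases j using Fin.cases <;>
    simp [Matrix.mul_apply, Fin.sum_univ_succ, Matrix.mulVec, dotProduct]

lemma bordered_one : bordered 1 0 0 (1 : Matrix (Fin m) (Fin m) ℂ) = 1 := by
  ext i j
  cases i using Fin.cases <;> cases j using Fin.cases <;>
    simp [Matrix.one_apply, Fin.succ_ne_zero, (Fin.succ_ne_zero _).symm]

lemma diagonal_cons_eq_bordered (w z : ℂ) :
    Matrix.diagonal (Fin.cons w fun _ : Fin m => z) =
      bordered w 0 0 (z • (1 : Matrix (Fin m) (Fin m) ℂ)) := by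
  ext i j
  cases i using Fin.cases <;> cases j using Fin.cases <;>
    simp [Matrix.diagonal_apply, Matrix.one_apply, Fin.succ_ne_zero, (Fin.succ_ne_zero _).symm]

lemma eq_bordered (A : Matrix (Fin (m + 1)) (Fin (m + 1)) ℂ) :
    A = bordered (A 0 0) (fun j => A 0 j.succ) (fun i => A i.succ 0) (deleteFirst A) := by
  ext i j
  cases i using Fin.cases <;> cases j using Fin.cases <;> simp [deleteFirst]

/-- `piMap` is invariant under conjugation by `[1] ⊕ T`. -/
lemma piMap_conj {T T' : Matrix (Fin m) (Fin m) ℂ} (h : T * T' = 1) :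
    piMap m (bordered a (Matrix.vecMul r T') (T.mulVec c) (T * B * T')) =
      piMap m (bordered a r c B) := by
  refine piMap_eq_of_forall_pencil fun w z => ?_
  rw [← det_one_sub_mul_structure]
  have hS : bordered 1 0 0 T * bordered 1 0 0 T' = 1 := by
    rw [mul_bordered, Matrix.mulVec_zero, h, bordered_one]
  have hX : bordered 1 0 0 T' * Matrix.diagonal (Fin.cons w fun _ : Fin m => z) =
      Matrix.diagonal (Fin.cons w fun _ : Fin m => z) * bordered 1 0 0 T' := by
    rw [diagonal_cons_eq_bordered, bordered_mul, mul_bordered]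
    simp
  have key : 1 - bordered a (Matrix.vecMul r T') (T.mulVec c) (T * B * T') *
      Matrix.diagonal (Fin.cons w fun _ => z) = bordered 1 0 0 T *
      (1 - bordered a r c B * Matrix.diagonal (Fin.cons w fun _ => z)) * bordered 1 0 0 T' := by
    rw [← bordered_mul, ← mul_bordered, mul_sub, sub_mul, mul_one, hS]
    simp only [Matrix.mul_assoc, hX]
  rw [key, Matrix.det_mul, Matrix.det_mul, mul_right_comm, ← Matrix.det_mul, hS, Matrix.det_one,
    one_mul]

end bordered

lemma submatrix_pencil {m : ℕ} (A : Matrix (Fin (m + 1)) (Fin (m + 1)) ℂ) (w z : ℂ) :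
    (1 - A * Matrix.diagonal (Fin.cons w fun _ => z)).submatrix Fin.succ Fin.succ =
      1 - z • deleteFirst A := by
  ext i j
  simp [Matrix.mul_diagonal, deleteFirst, Matrix.one_apply, mul_comm]

/-- `det (1 - z A^•)` is the first polynomial attached to `piMap`. -/
lemma det_one_sub_smul_deleteFirst {m : ℕ} (A : Matrix (Fin (m + 1)) (Fin (m + 1)) ℂ) (z : ℂ) :
    (1 - z • deleteFirst A).det = (denomPoly (piMap m A).2).eval z := by
  -- At w = 0 the first column of the pencil is e_0, so e_0 is fixed and Cramer's rule reduces to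
  -- the complementary block.
  have h := det_mul_eq_of_mulVec_eq_single
    (1 - A * Matrix.diagonal (Fin.cons 0 fun _ => z)) (Pi.single 0 1) 1 (by
      ext i
      simp [Matrix.mul_diagonal, Matrix.one_apply, Pi.single_apply])
  rw [submatrix_pencil, det_one_sub_mul_structure] at h
  simpa using h.symm

lemma charpolyRev_deleteFirst {m : ℕ} (A : Matrix (Fin (m + 1)) (Fin (m + 1)) ℂ) :
    (deleteFirst A).charpolyRev = denomPoly (piMap m A).2 := by
  refine Polynomial.funext fun z => ?_
  rw [← det_one_sub_smul_deleteFirst, Matrix.charpolyRev, ← Polynomial.coe_evalRingHom,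
    RingHom.map_det]
  congr 1
  ext i j
  by_cases h : i = j <;> simp [h] <;> ring

/-! ### The canonical matrix over a point (x, y) -/

/-- The companion matrix with first row `(y_1, -y_2, y_3, …)` and ones below the diagonal. -/
def signedCompanion {m : ℕ} (y : Fin m → ℂ) : Matrix (Fin m) (Fin m) ℂ :=
  Matrix.of fun i k =>
    if (i : ℕ) = 0 then (-1) ^ (k : ℕ) * y k else if (i : ℕ) = k + 1 then 1 else 0

/-- The first standard basis vector of `ℂ^m`. -/
def firstBasis (m : ℕ) : Fin m → ℂ := fun i => if (i : ℕ) = 0 then 1 else 0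

/-- The coordinates `x` of the matrix `[[a, r], [e_1, signedCompanion y]]`. -/
def canonicalX {m : ℕ} (a : ℂ) (r y : Fin m → ℂ) : Fin (m + 1) → ℂ :=
  Fin.cons a fun k => (-1) ^ ((k : ℕ) + 1) * r k + a * y k

/-- The row `r` for which `[[x_1, r], [e_1, signedCompanion y]]` has coordinates `(x, y)`. -/
def canonicalRow {m : ℕ} (x : Fin (m + 1) → ℂ) (y : Fin m → ℂ) : Fin m → ℂ :=
  fun k => (-1) ^ ((k : ℕ) + 1) * (x k.succ - x 0 * y k)

lemma neg_one_pow_mul_self (k : ℕ) : ((-1 : ℂ) ^ k) * (-1) ^ k = 1 := by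
  rw [← mul_pow]; simp

lemma canonicalX_canonicalRow {m : ℕ} (x : Fin (m + 1) → ℂ) (y : Fin m → ℂ) :
    canonicalX (x 0) (canonicalRow x y) y = x := by
  ext k
  cases k using Fin.cases with
  | zero => rfl
  | succ k =>
    simp only [canonicalX, canonicalRow, Fin.cons_succ, ← mul_assoc, neg_one_pow_mul_self]
    ring

lemma canonicalRow_canonicalX {m : ℕ} (a : ℂ) (r y : Fin m → ℂ) :
    canonicalRow (canonicalX a r y) y = r := by
  ext k
  simp only [canonicalX, canonicalRow, Fin.cons_succ, Fin.cons_zero, add_sub_cancel_right,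
    ← mul_assoc, neg_one_pow_mul_self, one_mul]

lemma eval_numPoly_canonicalX {m : ℕ} (a : ℂ) (r y : Fin m → ℂ) (z : ℂ) :
    (numPoly (canonicalX a r y)).eval z =
      a * (denomPoly y).eval z + z * ∑ k, r k * z ^ (k : ℕ) := by
  rw [eval_numPoly, eval_denomPoly, Fin.sum_univ_succ, mul_add, Finset.mul_sum, Finset.mul_sum,
    add_assoc, ← Finset.sum_add_distrib]
  simp only [canonicalX, Fin.cons_zero, Fin.cons_succ, Fin.val_zero, pow_zero, Fin.val_succ,
    one_mul, mul_one]
  congr 1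
  refine Finset.sum_congr rfl fun k _ => ?_
  linear_combination r k * z ^ ((k : ℕ) + 1) * neg_one_pow_mul_self ((k : ℕ) + 1)

/-- An inverse-free form of the resolvent: where p(z) ≠ 0, it says that (1 - zC)⁻¹ e_1 is the vector
of powers of z divided by p(z). -/
lemma one_sub_smul_signedCompanion_mulVec {m : ℕ} (y : Fin m → ℂ) (z : ℂ) :
    (1 - z • signedCompanion y).mulVec (fun k => z ^ (k : ℕ)) =
      (denomPoly y).eval z • firstBasis m := by
  ext i
  rw [Matrix.sub_mulVec, Matrix.one_mulVec, Matrix.smul_mulVec, eval_denomPoly]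
  simp only [Pi.sub_apply, Pi.smul_apply, smul_eq_mul, Matrix.mulVec, dotProduct, signedCompanion,
    Matrix.of_apply, firstBasis]
  by_cases hi : (i : ℕ) = 0
  · simp only [hi, if_true, pow_zero, mul_one, Finset.mul_sum, sub_eq_add_neg,
      ← Finset.sum_neg_distrib]
    congr 1
    refine Finset.sum_congr rfl fun k _ => ?_
    ring
  · obtain ⟨s, hs⟩ := Nat.exists_eq_succ_of_ne_zero hi
    have hsm : s < m := by omega
    rw [Finset.sum_eq_single (⟨s, hsm⟩ : Fin m)]
    · simp [hs, pow_succ, mul_comm]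
    · intro k _ hk
      have : ¬ (i : ℕ) = k + 1 := fun h => hk (Fin.ext (by simp; omega))
      simp [hi, this]
    · simp

lemma firstBasis_succ (m : ℕ) : firstBasis (m + 1) = Pi.single 0 1 := by
  ext i
  cases i using Fin.cases <;> simp [firstBasis]

lemma det_one_sub_smul_signedCompanion {m : ℕ} (y : Fin m → ℂ) (z : ℂ) :
    (1 - z • signedCompanion y).det = (denomPoly y).eval z := by
  cases m with
  | zero => simp [eval_denomPoly]
  | succ m =>
    have h := det_mul_eq_of_mulVec_eq_single _ _ ((denomPoly y).eval z)
      ((one_sub_smul_signedCompanion_mulVec y z).trans (by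
        rw [firstBasis_succ, ← Pi.single_smul, smul_eq_mul, mul_one]))
    -- Without its first row and column the matrix is lower triangular with ones on the diagonal, so
    -- the minor in Cramer's rule is 1.
    rw [Matrix.det_of_isLowerTriangular
      ((1 - z • signedCompanion y).submatrix Fin.succ Fin.succ)] at h
    · simpa [signedCompanion] using h
    · intro i j hij
      have hij' : i < j := hij
      have h1 : i ≠ j := hij'.ne
      have h2 : ¬ (i : ℕ) = j + 1 := by have : (i : ℕ) < j := hij'; omega
      simp [signedCompanion, h1, h2]

/-- The coordinates of the canonical matrix. -/
lemma piMap_canonical {m : ℕ} (a : ℂ) (r y : Fin m → ℂ) :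
    piMap m (bordered a r (firstBasis m) (signedCompanion y)) = (canonicalX a r y, y) := by
  set A := bordered a r (firstBasis m) (signedCompanion y) with hA
  -- The test vector (p(z), w, wz, wz², …) is sent to a multiple of e_0. Its first entry p(z) may
  -- vanish, so both sides keep a factor p, which is cancelled afterwards in the polynomial ring.
  have key : ∀ w z : ℂ, (denomPoly (piMap m A).2 * denomPoly y).eval z -
      w * (numPoly (piMap m A).1 * denomPoly y).eval z =
      (denomPoly y * denomPoly y).eval z -
        w * (numPoly (canonicalX a r y) * denomPoly y).eval z := by
    intro w z
    have h := det_mul_eq_of_mulVec_eq_single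
      (1 - A * Matrix.diagonal (Fin.cons w fun _ => z))
      (Fin.cons ((denomPoly y).eval z) fun k => w * z ^ (k : ℕ))
      ((denomPoly y).eval z - w * (numPoly (canonicalX a r y)).eval z) (by
        have hv := one_sub_smul_signedCompanion_mulVec y z
        rw [Matrix.sub_mulVec, Matrix.one_mulVec, Matrix.smul_mulVec] at hv
        have hD : (Matrix.diagonal (Fin.cons w fun _ : Fin m => z)).mulVec
            (Fin.cons ((denomPoly y).eval z) fun k => w * z ^ (k : ℕ)) =
            Fin.cons (w * (denomPoly y).eval z) fun k : Fin m => w * (z * z ^ (k : ℕ)) := by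
          ext i
          rw [Matrix.mulVec_diagonal]
          cases i using Fin.cases with
          | zero => simp
          | succ i => simp only [Fin.cons_succ]; ring
        ext i
        rw [Matrix.sub_mulVec, Matrix.one_mulVec, ← Matrix.mulVec_mulVec, hD]
        cases i using Fin.cases with
        | zero =>
          simp only [Pi.sub_apply, Matrix.mulVec, dotProduct,
            Fin.sum_univ_succ, Fin.cons_zero, Fin.cons_succ, hA, bordered_zero_zero,
            bordered_zero_succ, Pi.single_eq_same, eval_numPoly_canonicalX]
          have : ∑ k, r k * (w * (z * z ^ (k : ℕ))) = w * z * ∑ k, r k * z ^ (k : ℕ) := by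
            rw [Finset.mul_sum]
            exact Finset.sum_congr rfl fun k _ => by ring
          rw [this]
          ring
        | succ i =>
          have hvi := congrFun hv i
          simp only [Pi.sub_apply, Pi.smul_apply, smul_eq_mul, Matrix.mulVec, dotProduct] at hvi
          simp only [Pi.sub_apply, Matrix.mulVec, dotProduct,
            Fin.sum_univ_succ, Fin.cons_zero, Fin.cons_succ, hA, bordered_succ_zero,
            bordered_succ_succ]
          rw [Pi.single_eq_of_ne (Fin.succ_ne_zero i)]
          have h2 : ∑ k, signedCompanion y i k * (w * (z * z ^ (k : ℕ))) =
              w * z * ∑ k, signedCompanion y i k * z ^ (k : ℕ) := by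
            rw [Finset.mul_sum]
            exact Finset.sum_congr rfl fun k _ => by ring
          rw [h2]
          linear_combination w * hvi)
    rw [submatrix_pencil, hA, deleteFirst_bordered, det_one_sub_smul_signedCompanion, ← hA,
      det_one_sub_mul_structure] at h
    simp only [Polynomial.eval_mul]
    simp only [Fin.cons_zero] at h
    linear_combination h
  obtain ⟨h1, h2⟩ := eq_of_forall_eval_pencil_eq key
  exact Prod.ext (numPoly_injective (mul_right_cancel₀ (denomPoly_ne_zero y) h2))
    (denomPoly_injective (mul_right_cancel₀ (denomPoly_ne_zero y) h1))

/-- The canonical matrix with coordinates `(x, y)`. -/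
def canonicalMatrix {m : ℕ} (p : (Fin (m + 1) → ℂ) × (Fin m → ℂ)) :
    Matrix (Fin (m + 1)) (Fin (m + 1)) ℂ :=
  bordered (p.1 0) (canonicalRow p.1 p.2) (firstBasis m) (signedCompanion p.2)

lemma piMap_canonicalMatrix {m : ℕ} (p : (Fin (m + 1) → ℂ) × (Fin m → ℂ)) :
    piMap m (canonicalMatrix p) = p := by
  rw [canonicalMatrix, piMap_canonical, canonicalX_canonicalRow]

lemma piMap_surjective (m : ℕ) : Function.Surjective (piMap m) :=
  fun p => ⟨_, piMap_canonicalMatrix p⟩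

/-! ### Cyclic vectors and similarity to the companion form -/

/-- The intertwining relation gives T C^k e = B^k c, so the range of T contains a spanning set. -/
lemma range_mulVecLin_eq_top_of_isCyclicVector {ι : Type*} [Fintype ι] [DecidableEq ι]
    {B T C : Matrix ι ι ℂ} {c e : ι → ℂ} (hc : IsCyclicVector B c) (hBT : B * T = T * C)
    (he : T.mulVec e = c) : LinearMap.range T.mulVecLin = ⊤ := by
  rw [eq_top_iff, ← hc, Submodule.span_le]
  rintro _ ⟨k, rfl⟩
  have h : ∀ k : ℕ, B ^ k * T = T * C ^ k := by
    intro k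
    induction k with
    | zero => simp
    | succ k ih => rw [pow_succ, pow_succ, Matrix.mul_assoc, hBT, ← Matrix.mul_assoc, ih,
        Matrix.mul_assoc]
  refine ⟨(C ^ k).mulVec e, ?_⟩
  simp only [Matrix.mulVecLin_apply]
  rw [Matrix.mulVec_mulVec, ← h, ← Matrix.mulVec_mulVec, he]

/-- The columns of the transition matrix to the companion form. -/
noncomputable def hornerVector {m : ℕ} (B : Matrix (Fin m) (Fin m) ℂ) (c : Fin m → ℂ) :
    ℕ → Fin m → ℂ
  | 0 => c
  | k + 1 => B.mulVec (hornerVector B c k) + B.charpolyRev.coeff (k + 1) • c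

lemma hornerVector_eq_sum {m : ℕ} (B : Matrix (Fin m) (Fin m) ℂ) (c : Fin m → ℂ) (k : ℕ) :
    hornerVector B c k =
      ∑ i ∈ Finset.range (k + 1), B.charpolyRev.coeff i • (B ^ (k - i)).mulVec c := by
  induction k with
  | zero =>
    have : B.charpolyRev.coeff 0 = 1 := by
      rw [← Matrix.reverse_charpoly, Polynomial.coeff_zero_reverse]
      exact B.charpoly_monic
    simp [hornerVector, this]
  | succ k ih =>
    rw [hornerVector, ih, Finset.sum_range_succ _ (k + 1), Matrix.mulVec_sum]
    simp only [Matrix.mulVec_smul, Matrix.mulVec_mulVec, ← pow_succ', Nat.sub_self, pow_zero,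
      Matrix.one_mulVec]
    congr 1
    refine Finset.sum_congr rfl fun i hi => ?_
    rw [Finset.mem_range] at hi
    rw [show k + 1 - i = k - i + 1 by omega]

/-- Cayley–Hamilton: reversing the order of summation turns the sum into the characteristic
polynomial of B evaluated at B and applied to c. -/
lemma hornerVector_self {m : ℕ} (B : Matrix (Fin m) (Fin m) ℂ) (c : Fin m → ℂ) :
    hornerVector B c m = 0 := by
  have hd : B.charpoly.natDegree = m := by simp [Matrix.charpoly_natDegree_eq_dim]
  have h := congrArg (fun M => Matrix.mulVec M c) B.aeval_self_charpoly
  simp only [Polynomial.aeval_eq_sum_range, hd, Matrix.sum_mulVec, Matrix.zero_mulVec] at h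
  rw [hornerVector_eq_sum, ← h, ← Finset.sum_range_reflect]
  refine Finset.sum_congr rfl fun i hi => ?_
  rw [Finset.mem_range] at hi
  rw [← Matrix.reverse_charpoly, Polynomial.coeff_reverse, hd,
    Polynomial.revAt_le (by omega), Matrix.smul_mulVec]
  rw [show m - (m + 1 - 1 - i) = i by omega]

/-- A matrix with a cyclic vector is similar to the companion matrix of its characteristic
polynomial. -/
lemma exists_conj_signedCompanion {m : ℕ} (hm : 1 ≤ m) {B : Matrix (Fin m) (Fin m) ℂ}
    {c : Fin m → ℂ} (hc : IsCyclicVector B c) {y : Fin m → ℂ} (hy : B.charpolyRev = denomPoly y) :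
    ∃ T : Matrix (Fin m) (Fin m) ℂ, T.det ≠ 0 ∧ B * T = T * signedCompanion y ∧
      T.mulVec (firstBasis m) = c := by
  let T : Matrix (Fin m) (Fin m) ℂ := Matrix.of fun i k => hornerVector B c k i
  have he : T.mulVec (firstBasis m) = c := by
    ext i
    simp only [Matrix.mulVec, dotProduct, T, Matrix.of_apply, firstBasis, mul_ite, mul_one,
      mul_zero]
    rw [Finset.sum_eq_single (⟨0, hm⟩ : Fin m)]
    · simp [hornerVector]
    · intro k _ hk
      rw [if_neg fun h => hk (Fin.ext h)]
    · simp
  have hBT : B * T = T * signedCompanion y := by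
    ext i k
    have h1 : (B * T) i k = B.mulVec (hornerVector B c k) i := rfl
    have h2 : B.mulVec (hornerVector B c k) =
        hornerVector B c (k + 1) - B.charpolyRev.coeff (k + 1) • c := by
      rw [hornerVector, add_sub_cancel_right]
    have h3 : (T * signedCompanion y) i k = (-1) ^ (k : ℕ) * y k * c i +
        hornerVector B c (k + 1) i := by
      simp only [Matrix.mul_apply, T, signedCompanion, Matrix.of_apply]
      rw [← Finset.add_sum_erase _ _ (Finset.mem_univ (⟨0, hm⟩ : Fin m))]
      have h00 : hornerVector B c 0 = c := rfl
      simp only [if_true, h00]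
      congr 1
      · ring
      · by_cases hk : (k : ℕ) + 1 < m
        · rw [Finset.sum_eq_single (⟨k + 1, hk⟩ : Fin m)]
          · simp
          · intro l hl hlk
            have h0 : (l : ℕ) ≠ 0 := fun h => (Finset.mem_erase.1 hl).1 (Fin.ext h)
            have h1 : (l : ℕ) ≠ k + 1 := fun h => hlk (Fin.ext h)
            simp [h0, h1]
          · simp [Fin.ext_iff]
        -- The last column has no successor in T; the recursion closes because the Horner vector of
        -- index m vanishes.
        · have hkm : (k : ℕ) + 1 = m := by omega
          have := congrFun (hornerVector_self B c) i
          rw [hkm, this]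
          refine Finset.sum_eq_zero fun l hl => ?_
          have h0 : (l : ℕ) ≠ 0 := fun h => (Finset.mem_erase.1 hl).1 (Fin.ext h)
          have h1 : (l : ℕ) ≠ m := l.2.ne
          simp [h0, h1]
    rw [h1, h2, h3, hy, coeff_denomPoly_succ]
    simp only [Pi.sub_apply, Pi.smul_apply, smul_eq_mul, pow_succ]
    ring
  refine ⟨T, ?_, hBT, he⟩
  have hT := range_mulVecLin_eq_top_of_isCyclicVector hc hBT he
  rw [LinearMap.range_eq_top] at hT
  exact ((Matrix.isUnit_iff_isUnit_det T).1 (Matrix.mulVec_surjective_iff_isUnit.1 hT)).ne_zero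

/-- Every matrix whose first column is cyclic is obtained from the canonical matrix with the same
coordinates through conjugation by some `[1] ⊕ T`. -/
lemma exists_eq_conj_canonicalMatrix {m : ℕ} (hm : 1 ≤ m)
    {W : Matrix (Fin (m + 1)) (Fin (m + 1)) ℂ}
    (hW : IsCyclicVector (deleteFirst W) fun i => W i.succ 0) :
    ∃ T : Matrix (Fin m) (Fin m) ℂ, T.det ≠ 0 ∧ ∀ T', T * T' = 1 →
      bordered 1 0 0 T * canonicalMatrix (piMap m W) * bordered 1 0 0 T' = W := by
  obtain ⟨T, hdet, hBT, he⟩ := exists_conj_signedCompanion hm hW (charpolyRev_deleteFirst W)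
  refine ⟨T, hdet, fun T' hT => ?_⟩
  set y := (piMap m W).2 with hy
  set r := Matrix.vecMul (fun j => W 0 j.succ) T with hr
  have hWT : bordered (W 0 0) (Matrix.vecMul r T') (T.mulVec (firstBasis m))
      (T * signedCompanion y * T') = W := by
    rw [← hBT, Matrix.mul_assoc, hT, hr, Matrix.vecMul_vecMul, hT, he, Matrix.mul_one,
      Matrix.vecMul_one]
    exact (eq_bordered W).symm
  -- W is already a conjugate of a canonical matrix with corner W 0 0 and row r; invariance
  -- identifies its coordinates, so that r is the row recovered from them.
  have hpi : piMap m W = (canonicalX (W 0 0) r y, y) := by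
    rw [← piMap_canonical, ← hWT, piMap_conj _ _ _ _ hT, hWT]
  rw [canonicalMatrix, ← hy, hpi, mul_bordered, bordered_mul, canonicalRow_canonicalX]
  exact hWT

/-! ### Interpolation by entire invertible matrices -/

lemma differentiable_mul_apply {ι : Type*} [Fintype ι] {S T : ℂ → Matrix ι ι ℂ}
    (hS : ∀ a b, Differentiable ℂ fun z => S z a b)
    (hT : ∀ a b, Differentiable ℂ fun z => T z a b) (a b : ι) :
    Differentiable ℂ fun z => (S z * T z) a b := by
  simp only [Matrix.mul_apply]
  exact Differentiable.fun_sum fun k _ => (hS a k).mul (hT k b)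

/-- An entire map into invertible matrices with a prescribed value at one node and value `1` at the
others. -/
lemma exists_entire_invertible_single {ι κ : Type*} [Fintype ι] [DecidableEq ι] [Fintype κ]
    [DecidableEq κ] {ζ : κ → ℂ} (hζ : Function.Injective ζ) (j : κ) {A : Matrix ι ι ℂ}
    (hA : A.det ≠ 0) :
    ∃ T T' : ℂ → Matrix ι ι ℂ, (∀ a b, Differentiable ℂ fun z => T z a b) ∧
      (∀ a b, Differentiable ℂ fun z => T' z a b) ∧ (∀ z, T z * T' z = 1) ∧
      T (ζ j) = A ∧ ∀ i, i ≠ j → T (ζ i) = 1 := by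
  let p : Polynomial ℂ := Lagrange.basis Finset.univ ζ j
  have hp1 : p.eval (ζ j) = 1 := Lagrange.eval_basis_self hζ.injOn (Finset.mem_univ j)
  have hp0 : ∀ i, i ≠ j → p.eval (ζ i) = 0 := fun i hi =>
    Lagrange.eval_basis_of_ne hi.symm (Finset.mem_univ i)
  have hpd : Differentiable ℂ fun z => p.eval z := p.differentiable
  -- Invertible matrices are products of diagonal ones and transvections. Each factor is deformed to
  -- 1 through the Lagrange polynomial p, equal to 1 at ζ_j and 0 at the other nodes: D_i becomes
  -- exp(p log D_i), and a transvection has its parameter multiplied by p.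
  refine Matrix.diagonal_transvection_induction_of_det_ne_zero
    (fun A => ∃ T T' : ℂ → Matrix ι ι ℂ, (∀ a b, Differentiable ℂ fun z => T z a b) ∧
      (∀ a b, Differentiable ℂ fun z => T' z a b) ∧ (∀ z, T z * T' z = 1) ∧
      T (ζ j) = A ∧ ∀ i, i ≠ j → T (ζ i) = 1) A hA ?_ ?_ ?_
  · intro D hD
    have hD0 : ∀ i, D i ≠ 0 := by
      rw [Matrix.det_diagonal, Finset.prod_ne_zero_iff] at hD
      exact fun i => hD i (Finset.mem_univ i)
    refine ⟨fun z => Matrix.diagonal fun i => Complex.exp (p.eval z * Complex.log (D i)),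
      fun z => Matrix.diagonal fun i => Complex.exp (-(p.eval z * Complex.log (D i))),
      fun a b => ?_, fun a b => ?_, fun z => ?_, ?_, fun i hi => ?_⟩
    · by_cases hab : a = b
      · subst hab
        simpa using (hpd.mul_const _).cexp
      · simp [hab]
    · by_cases hab : a = b
      · subst hab
        simpa using (hpd.mul_const _).neg.cexp
      · simp [hab]
    · simp [Matrix.diagonal_mul_diagonal, ← Complex.exp_add]
    · simp [hp1, Complex.exp_log, hD0]
    · simp [hp0 i hi]
  · intro t
    refine ⟨fun z => Matrix.transvection t.i t.j (p.eval z * t.c),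
      fun z => Matrix.transvection t.i t.j (-(p.eval z * t.c)),
      fun a b => ?_, fun a b => ?_, fun z => ?_, ?_, fun i hi => ?_⟩
    · simp only [Matrix.transvection, Matrix.add_apply, Matrix.single_apply]
      split_ifs
      · exact (hpd.mul_const t.c).const_add _
      · exact differentiable_const _
    · simp only [Matrix.transvection, Matrix.add_apply, Matrix.single_apply]
      split_ifs
      · exact (hpd.mul_const t.c).neg.const_add _
      · exact differentiable_const _
    · rw [Matrix.transvection_mul_transvection_same _ _ t.hij, add_neg_cancel,
        Matrix.transvection_zero]
    · simp [hp1, Matrix.TransvectionStruct.toMatrix]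
    · simp [hp0 i hi]
  · rintro A B - - ⟨T, T', hT, hT', h1, h2, h3⟩ ⟨S, S', hS, hS', k1, k2, k3⟩
    refine ⟨fun z => T z * S z, fun z => S' z * T' z, differentiable_mul_apply hT hS,
      differentiable_mul_apply hS' hT', fun z => ?_, by simp only [h2, k2], fun i hi => ?_⟩
    · rw [Matrix.mul_assoc, ← Matrix.mul_assoc (S z), k1, Matrix.one_mul, h1]
    · simp only [h3 i hi, k3 i hi, Matrix.one_mul]

/-- Interpolation of invertible matrices by an entire map into invertible matrices. -/
lemma exists_entire_invertible_interpolation {ι κ : Type*} [Fintype ι] [DecidableEq ι] [Fintype κ]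
    [DecidableEq κ] {ζ : κ → ℂ} (hζ : Function.Injective ζ) {A : κ → Matrix ι ι ℂ}
    (hA : ∀ j, (A j).det ≠ 0) :
    ∃ T T' : ℂ → Matrix ι ι ℂ, (∀ a b, Differentiable ℂ fun z => T z a b) ∧
      (∀ a b, Differentiable ℂ fun z => T' z a b) ∧ (∀ z, T z * T' z = 1) ∧
      ∀ j, T (ζ j) = A j := by
  suffices h : ∀ s : Finset κ, ∃ T T' : ℂ → Matrix ι ι ℂ,
      (∀ a b, Differentiable ℂ fun z => T z a b) ∧
      (∀ a b, Differentiable ℂ fun z => T' z a b) ∧ (∀ z, T z * T' z = 1) ∧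
      ∀ j, T (ζ j) = if j ∈ s then A j else 1 by
    simpa using h Finset.univ
  intro s
  induction s using Finset.induction_on with
  | empty => exact ⟨fun _ => 1, fun _ => 1, by simp, by simp, by simp, by simp⟩
  | insert j s hj ih =>
    obtain ⟨T, T', hT, hT', h1, h2⟩ := ih
    obtain ⟨S, S', hS, hS', k1, k2, k3⟩ := exists_entire_invertible_single hζ j (hA j)
    refine ⟨fun z => T z * S z, fun z => S' z * T' z, differentiable_mul_apply hT hS,
      differentiable_mul_apply hS' hT', fun z => ?_, fun i => ?_⟩
    · rw [Matrix.mul_assoc, ← Matrix.mul_assoc (S z), k1, Matrix.one_mul, h1]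
    · by_cases hij : i = j
      · subst hij
        simp [h2, hj, k2]
      · simp [h2, hij, k3 i hij]

/-! ### The unit μ-ball as a preimage -/

lemma norm_toEuclideanCLM_structure {m : ℕ} (hm : 1 ≤ m) (w z : ℂ) :
    ‖Matrix.toEuclideanCLM (n := Fin (m + 1)) (𝕜 := ℂ)
      (Matrix.diagonal (Fin.cons w fun _ : Fin m => z))‖ = max ‖w‖ ‖z‖ := by
  rw [Matrix.l2_opNorm_toEuclideanCLM, Matrix.l2_opNorm_diagonal]
  refine le_antisymm ((pi_norm_le_iff_of_nonneg (le_max_of_le_left (norm_nonneg w))).2 fun i => ?_)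
    (max_le ?_ ?_)
  · cases i using Fin.cases <;> simp
  · exact norm_le_pi_norm (Fin.cons w fun _ : Fin m => z : Fin (m + 1) → ℂ) 0
  -- The entry z occurs in the matrix only because m ≥ 1.
  · exact norm_le_pi_norm (Fin.cons w fun _ : Fin m => z : Fin (m + 1) → ℂ) (Fin.succ ⟨0, hm⟩)

/-- `Ω_{1,n}` is the preimage of `𝔾_{1,n}` under `π_n`. -/
lemma mem_Omega_iff {m : ℕ} (hm : 1 ≤ m) (A : Matrix (Fin (m + 1)) (Fin (m + 1)) ℂ) :
    A ∈ Omega m ↔ piMap m A ∈ muQuotient m := by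
  rw [Omega, muBall, Set.mem_ofPred_eq, structuredSingularValue, ENNReal.inv_lt_one,
    mem_muQuotient_iff]
  simp only [← det_one_sub_mul_structure]
  constructor
  · intro h z w hz hw h0
    refine absurd h (not_lt.2 ?_)
    refine (iInf₂_le (Matrix.diagonal (Fin.cons w fun _ : Fin m => z)) ⟨⟨w, z, rfl⟩, h0⟩).trans ?_
    rw [← ofReal_norm, norm_toEuclideanCLM_structure hm, ← ENNReal.ofReal_one]
    exact ENNReal.ofReal_le_ofReal (max_le hw hz)
  · intro h
    -- The infimum has to exceed 1 strictly. The closed bidisc is the unit ball of the sup norm, so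
    -- by compactness nonvanishing persists on a ball of radius 1 + δ.
    let U : Set (ℂ × ℂ) :=
      {q | (1 - A * Matrix.diagonal (Fin.cons q.1 fun _ : Fin m => q.2)).det ≠ 0}
    have hU : IsOpen U := by
      refine isOpen_ne_fun ?_ continuous_const
      simp only [det_one_sub_mul_structure]
      fun_prop
    have hsub : Metric.closedBall (0 : ℂ × ℂ) 1 ⊆ U := by
      intro q hq
      rw [mem_closedBall_zero_iff, Prod.norm_def, max_le_iff] at hq
      exact h q.2 q.1 hq.2 hq.1
    obtain ⟨δ, hδ, hthick⟩ :=
      (isCompact_closedBall (0 : ℂ × ℂ) 1).exists_thickening_subset_open hU hsub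
    rw [thickening_closedBall hδ zero_le_one] at hthick
    have h1 : (1 : ℝ≥0∞) < ENNReal.ofReal (δ + 1) := by
      rw [← ENNReal.ofReal_one]
      exact (ENNReal.ofReal_lt_ofReal_iff (by linarith)).2 (by linarith)
    refine h1.trans_le (le_iInf₂ ?_)
    rintro _ ⟨⟨w, z, rfl⟩, h0⟩
    rw [← ofReal_norm, norm_toEuclideanCLM_structure hm]
    refine ENNReal.ofReal_le_ofReal (not_lt.1 fun hlt => ?_)
    have : ((w, z) : ℂ × ℂ) ∈ U := hthick (by rwa [mem_ball_zero_iff, Prod.norm_def])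
    exact this h0

/-! ### Krylov determinants and the null set -/

/-- The matrix with columns `c, B c, B² c, …`. -/
def krylovMatrix {m : ℕ} {R : Type*} [CommRing R] (B : Matrix (Fin m) (Fin m) R) (c : Fin m → R) :
    Matrix (Fin m) (Fin m) R :=
  Matrix.of fun i k => (B ^ (k : ℕ)).mulVec c i

lemma isCyclicVector_of_det_krylovMatrix_ne_zero {m : ℕ} {B : Matrix (Fin m) (Fin m) ℂ}
    {c : Fin m → ℂ} (h : (krylovMatrix B c).det ≠ 0) : IsCyclicVector B c := by
  have hu : IsUnit (krylovMatrix B c) := (Matrix.isUnit_iff_isUnit_det _).2 h.isUnit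
  rw [IsCyclicVector, eq_top_iff]
  rintro v -
  obtain ⟨u, rfl⟩ := Matrix.mulVec_surjective_iff_isUnit.2 hu v
  rw [Matrix.mulVec_eq_sum]
  refine Submodule.sum_mem _ fun k _ => ?_
  rw [op_smul_eq_smul]
  exact Submodule.smul_mem _ _ (Submodule.subset_span ⟨k, rfl⟩)

lemma map_krylovMatrix {m : ℕ} {R S : Type*} [CommRing R] [CommRing S] (f : R →+* S)
    (B : Matrix (Fin m) (Fin m) R) (c : Fin m → R) :
    f.mapMatrix (krylovMatrix B c) = krylovMatrix (f.mapMatrix B) (f ∘ c) := by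
  ext i k
  simp only [krylovMatrix, RingHom.mapMatrix_apply, Matrix.map_apply, Matrix.of_apply]
  rw [RingHom.map_mulVec, Matrix.map_pow]

/-- Column k is homogeneous of degree k + 1 in the pair (B, c); this permits replacing the line
parameter t by its inverse. -/
lemma krylovMatrix_smul {m : ℕ} {R : Type*} [CommRing R] (t : R) (B : Matrix (Fin m) (Fin m) R)
    (c : Fin m → R) :
    krylovMatrix (t • B) (t • c) =
      krylovMatrix B c * Matrix.diagonal fun k : Fin m => t ^ ((k : ℕ) + 1) := by
  ext i k
  simp only [krylovMatrix, Matrix.mul_diagonal, Matrix.of_apply, smul_pow, Matrix.smul_mulVec,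
    Matrix.mulVec_smul, Pi.smul_apply, smul_eq_mul, pow_succ]
  ring

/-- The companion matrix with y = 0 shifts each basis vector to the next, so the Krylov columns are
the standard basis. -/
lemma krylovMatrix_shift (m : ℕ) :
    krylovMatrix (signedCompanion (0 : Fin m → ℂ)) (firstBasis m) = 1 := by
  have h : ∀ k : ℕ, k < m → ((signedCompanion (0 : Fin m → ℂ)) ^ k).mulVec (firstBasis m) =
      fun i : Fin m => if (i : ℕ) = k then (1 : ℂ) else 0 := by
    intro k
    induction k with
    | zero => intro _; rw [pow_zero, Matrix.one_mulVec]; rfl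
    | succ k ih =>
      intro hk
      rw [pow_succ', ← Matrix.mulVec_mulVec, ih (by omega)]
      ext i
      simp only [Matrix.mulVec, dotProduct, signedCompanion, Matrix.of_apply, Pi.zero_apply,
        mul_zero, mul_ite, mul_one]
      rw [Finset.sum_eq_single (⟨k, by omega⟩ : Fin m)]
      · by_cases hi : (i : ℕ) = 0 <;> simp [hi]
      · intro l _ hl
        rw [if_neg fun h => hl (Fin.ext h)]
      · simp
  ext i k
  simp [krylovMatrix, h k k.2, Matrix.one_apply, Fin.ext_iff]

/-- Along the direction of the shift, the Krylov determinant vanishes only finitely often. -/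
lemma finite_det_krylovMatrix_line {m : ℕ} (B : Matrix (Fin m) (Fin m) ℂ) (c : Fin m → ℂ) :
    {t : ℂ | (krylovMatrix (B + t • signedCompanion 0) (c + t • firstBasis m)).det = 0}.Finite := by
  -- In the variable s = t⁻¹ the point at infinity of the line becomes s = 0, where the Krylov
  -- matrix is that of the shift and q equals 1. Hence q ≠ 0.
  let q : Polynomial ℂ := (krylovMatrix
    ((Polynomial.X : Polynomial ℂ) • B.map Polynomial.C + (signedCompanion 0).map Polynomial.C)
    (fun i => Polynomial.X * Polynomial.C (c i) + Polynomial.C (firstBasis m i))).det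
  have hq : ∀ s : ℂ, q.eval s =
      (krylovMatrix (s • B + signedCompanion 0) (s • c + firstBasis m)).det := by
    intro s
    rw [← Polynomial.coe_evalRingHom, RingHom.map_det, map_krylovMatrix]
    congr 2
    · ext i j
      change Polynomial.eval s (Polynomial.X * Polynomial.C (B i j) +
        Polynomial.C (signedCompanion 0 i j)) = s * B i j + signedCompanion 0 i j
      rw [Polynomial.eval_add, Polynomial.eval_mul, Polynomial.eval_X, Polynomial.eval_C,
        Polynomial.eval_C]
    · ext i
      change Polynomial.eval s (Polynomial.X * Polynomial.C (c i) +
        Polynomial.C (firstBasis m i)) = s * c i + firstBasis m i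
      rw [Polynomial.eval_add, Polynomial.eval_mul, Polynomial.eval_X, Polynomial.eval_C,
        Polynomial.eval_C]
  have hq0 : q ≠ 0 := by
    intro h
    have := hq 0
    rw [h, zero_smul, zero_smul, zero_add, zero_add, krylovMatrix_shift] at this
    simp at this
  refine ((Set.finite_singleton (0 : ℂ)).union
    ((q.rootSet_finite ℂ).image fun s => s⁻¹)).subset ?_
  intro t ht
  rw [Set.mem_ofPred_eq] at ht
  by_cases ht0 : t = 0
  · exact Or.inl ht0
  · refine Or.inr ⟨t⁻¹, ?_, inv_inv t⟩
    have h1 : B + t • signedCompanion 0 = t • (t⁻¹ • B + signedCompanion 0) := by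
      rw [smul_add, smul_smul, mul_inv_cancel₀ ht0, one_smul]
    have h2 : c + t • firstBasis m = t • (t⁻¹ • c + firstBasis m) := by
      rw [smul_add, smul_smul, mul_inv_cancel₀ ht0, one_smul]
    rw [h1, h2, krylovMatrix_smul, Matrix.det_mul, ← hq, Matrix.det_diagonal, mul_eq_zero] at ht
    rw [Polynomial.mem_rootSet]
    refine ⟨hq0, ?_⟩
    simpa using ht.resolve_right (Finset.prod_ne_zero_iff.2 fun k _ => pow_ne_zero _ ht0)

open MeasureTheory in
lemma ae_det_krylovMatrix_ne_zero (m : ℕ) :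
    ∀ᵐ a : Fin (m + 1) → Fin (m + 1) → ℂ,
      (krylovMatrix (deleteFirst (Matrix.of a)) fun i => a i.succ 0).det ≠ 0 := by
  let A₀ : Fin (m + 1) → Fin (m + 1) → ℂ :=
    bordered 0 0 (firstBasis m) (signedCompanion 0)
  have : ∀ _ : Fin (m + 1), (volume : Measure (Fin (m + 1) → ℂ)).IsAddHaarMeasure :=
    fun _ => inferInstance
  have : (volume : Measure (Fin (m + 1) → Fin (m + 1) → ℂ)).IsAddHaarMeasure :=
    Measure.pi.isAddHaarMeasure _
  -- Fubini along the direction A₀: it suffices that on each translate of the line ℂ·A₀ almost every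
  -- point has nonzero determinant.
  refine ae_mem_of_ae_add_linearMap_mem (LinearMap.toSpanSingleton ℂ _ A₀) volume volume
    (s := {a | (krylovMatrix (deleteFirst (Matrix.of a)) fun i => a i.succ 0).det ≠ 0}) ?_ ?_
  · refine (isOpen_ne_fun ?_ continuous_const).measurableSet
    have hB : Continuous fun a : Fin (m + 1) → Fin (m + 1) → ℂ => deleteFirst (Matrix.of a) :=
      continuous_matrix fun i j => continuous_apply_apply i.succ j.succ
    refine Continuous.matrix_det (continuous_matrix fun i k => ?_)
    exact (continuous_apply i).comp
      ((hB.pow k).matrix_mulVec (continuous_pi fun i =>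
        continuous_apply_apply i.succ 0))
  · intro y
    exact compl_mem_ae_iff.2 ((finite_det_krylovMatrix_line (deleteFirst (Matrix.of y))
      fun i => y i.succ 0).measure_zero volume)

/-! ### Holomorphy, lifting and the theorem -/

lemma differentiable_piMap (m : ℕ) : Differentiable ℂ (piMap m) := by
  have hdet : ∀ I : Finset (Fin (m + 1)), Differentiable ℂ
      fun A : Fin (m + 1) → Fin (m + 1) → ℂ => principalMinor (Matrix.of A) I := by
    intro I
    simp only [principalMinor, Matrix.det_apply, Matrix.submatrix_apply, Matrix.of_apply]
    fun_prop
  change Differentiable ℂ fun A : Fin (m + 1) → Fin (m + 1) → ℂ => piMap m (Matrix.of A)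
  refine Differentiable.prodMk (differentiable_pi.2 fun j => ?_) (differentiable_pi.2 fun j => ?_)
  · exact Differentiable.fun_sum fun I _ => hdet I
  · exact Differentiable.fun_sum fun I _ => hdet I

lemma differentiableOn_canonicalMatrix {m : ℕ} {f : ℂ → (Fin (m + 1) → ℂ) × (Fin m → ℂ)}
    {s : Set ℂ} (hf : DifferentiableOn ℂ f s) (i j : Fin (m + 1)) :
    DifferentiableOn ℂ (fun z => canonicalMatrix (f z) i j) s := by
  have h1 : ∀ k, DifferentiableOn ℂ (fun z => (f z).1 k) s := differentiableOn_pi.1 hf.fst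
  have h2 : ∀ k, DifferentiableOn ℂ (fun z => (f z).2 k) s := differentiableOn_pi.1 hf.snd
  cases i using Fin.cases with
  | zero =>
    cases j using Fin.cases with
    | zero => exact h1 0
    | succ j => exact ((h1 _).sub ((h1 0).mul (h2 j))).const_mul _
  | succ i =>
    cases j using Fin.cases with
    | zero => exact differentiableOn_const _
    | succ j =>
      simp only [canonicalMatrix, bordered_succ_succ, signedCompanion, Matrix.of_apply]
      split_ifs
      · exact (h2 j).const_mul _
      all_goals exact differentiableOn_const _

lemma differentiable_bordered_one {m : ℕ} {T : ℂ → Matrix (Fin m) (Fin m) ℂ}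
    (hT : ∀ a b, Differentiable ℂ fun z => T z a b) (i j : Fin (m + 1)) :
    Differentiable ℂ fun z => bordered 1 0 0 (T z) i j := by
  cases i using Fin.cases <;> cases j using Fin.cases <;> simp [hT]

/-- Lifting of holomorphic maps through `π_n`, with prescribed values at finitely many nodes. -/
lemma exists_holomorphic_lift {m : ℕ} (hm : 1 ≤ m) {κ : Type*} [Fintype κ] [DecidableEq κ]
    {ζ : κ → ℂ} (hζ : Function.Injective ζ) {W : κ → Matrix (Fin (m + 1)) (Fin (m + 1)) ℂ}
    (hW : ∀ j, IsCyclicVector (deleteFirst (W j)) fun i => W j i.succ 0)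
    {f : ℂ → (Fin (m + 1) → ℂ) × (Fin m → ℂ)} {s : Set ℂ} (hf : DifferentiableOn ℂ f s)
    (hfW : ∀ j, f (ζ j) = piMap m (W j)) :
    ∃ F : ℂ → Matrix (Fin (m + 1)) (Fin (m + 1)) ℂ, DifferentiableOn ℂ F s ∧
      (∀ z, piMap m (F z) = f z) ∧ ∀ j, F (ζ j) = W j := by
  choose A hdet hA using fun j => exists_eq_conj_canonicalMatrix hm (hW j)
  obtain ⟨T, T', hT, hT', h1, h2⟩ := exists_entire_invertible_interpolation hζ hdet
  refine ⟨fun z => bordered 1 0 0 (T z) * canonicalMatrix (f z) * bordered 1 0 0 (T' z),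
    ?_, fun z => ?_, fun j => ?_⟩
  · refine differentiableOn_pi.2 fun i => differentiableOn_pi.2 fun j => ?_
    simp only [Matrix.mul_apply]
    refine DifferentiableOn.fun_sum fun k _ => DifferentiableOn.mul
      (DifferentiableOn.fun_sum fun l _ => DifferentiableOn.mul
        (differentiable_bordered_one hT _ _).differentiableOn
        (differentiableOn_canonicalMatrix hf _ _))
      (differentiable_bordered_one hT' _ _).differentiableOn
  · dsimp only
    rw [canonicalMatrix, mul_bordered, bordered_mul, piMap_conj _ _ _ _ (h1 z)]
    exact piMap_canonicalMatrix (f z)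
  · dsimp only
    rw [hfW, h2]
    -- At the node, T' (ζ j) is a right inverse of the prescribed conjugating matrix.
    exact hA j _ (by rw [← h2]; exact h1 _)

/-- Here `n = m + 1 ≥ 2`. -/
theorem theorem1p2 (m : ℕ) (hm : 1 ≤ m) :
    -- the complement of the generic set is Lebesgue null in `ℂ^{n×n}`
    MeasureTheory.volume
      {a : Fin (m + 1) → Fin (m + 1) → ℂ | Matrix.of a ∈ Omega m \ OmegaTilde m} = 0 ∧
    -- `π_n` is holomorphic and maps `Ω_{1,n}` onto `𝔾_{1,n}`
    (Differentiable ℂ (piMap m) ∧ piMap m '' Omega m = muQuotient m) ∧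
    -- equivalence of the two Nevanlinna--Pick problems
    ∀ (M : ℕ) (ζ : Fin M → ℂ) (W : Fin M → Matrix (Fin (m + 1)) (Fin (m + 1)) ℂ),
      Function.Injective ζ → (∀ j, ζ j ∈ Metric.ball (0 : ℂ) 1) → (∀ j, W j ∈ OmegaTilde m) →
      ((∃ F : ℂ → Matrix (Fin (m + 1)) (Fin (m + 1)) ℂ,
          DifferentiableOn ℂ F (Metric.ball 0 1) ∧
          (∀ z ∈ Metric.ball (0 : ℂ) 1, F z ∈ Omega m) ∧ ∀ j, F (ζ j) = W j) ↔
        ∃ f : ℂ → (Fin (m + 1) → ℂ) × (Fin m → ℂ),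
          DifferentiableOn ℂ f (Metric.ball 0 1) ∧
          (∀ z ∈ Metric.ball (0 : ℂ) 1, f z ∈ muQuotient m) ∧
          ∀ j, f (ζ j) = piMap m (W j)) := by
  refine ⟨?_, ⟨differentiable_piMap m, ?_⟩, fun M ζ W hζ _ hW => ⟨?_, ?_⟩⟩
  · refine MeasureTheory.measure_mono_null ?_ (ae_det_krylovMatrix_ne_zero m)
    rintro a ⟨ha, hna⟩ hdet
    have hc := isCyclicVector_of_det_krylovMatrix_ne_zero hdet
    exact hna ⟨ha, ⟨_, hc⟩, hc⟩
  · have : Omega m = piMap m ⁻¹' muQuotient m := Set.ext (mem_Omega_iff hm)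
    rw [this, Set.image_preimage_eq _ (piMap_surjective m)]
  · rintro ⟨F, hF, hFΩ, hFW⟩
    have hπ : Differentiable ℂ fun a : Fin (m + 1) → Fin (m + 1) → ℂ => piMap m (Matrix.of a) :=
      differentiable_piMap m
    have hF' : DifferentiableOn ℂ (fun z => Matrix.of.symm (F z)) (Metric.ball 0 1) := hF
    exact ⟨piMap m ∘ F, hπ.comp_differentiableOn hF',
      fun z hz => (mem_Omega_iff hm _).1 (hFΩ z hz), fun j => congrArg _ (hFW j)⟩
  · rintro ⟨f, hf, hfG, hfW⟩
    obtain ⟨F, hF, hFf, hFW⟩ := exists_holomorphic_lift hm hζ (fun j => (hW j).2.2) hf hfW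
    exact ⟨F, hF, fun z hz => (mem_Omega_iff hm _).2 (by rw [hFf]; exact hfG z hz), hFW⟩
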